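/- Let $p$ be a prime and let $K$ be a finite, possibly inseparable, extension of $\mathbb{F}_p(t)$. For a place $\mathfrak{p}$ of $K$ let $v_{\mathfrak p}$ be the associated valuation, normalized so that $v_{\mathfrak p}(K^*)=\mathbb{Z}$. Let $S$ be a finite set of places of $K$ with $|S|\ge 1$, and put $$R_S=\{x\in K : v_{\mathfrak p}(x)\ge 0 \text{ for all } \mathfrak p\notin S\},\qquad R_S^*=\{x\in K^* : v_{\mathfrak p}(x)=0 \text{ for all } \mathfrak p\notin S\}.$$ Let $h$ be the class number of $R_S$, let $\mathbf a_1,\dots,\mathbf a_h$ be ideals of $R_S$ representing the ideal classes of $R_S$, let $\alpha_i\in R_S$ satisfy $\mathbf a_i^h=\alpha_iR_S$, and let $L=K(\zeta,\sqrt[h]{\alpha_1},\dots,\sqrt[h]{\alpha_h})$, where $\sqrt[h]{\alpha_i}$ is a chosen $h$-th root of $\alpha_i$ and $\zeta$ is a generator of the group of $h$-th roots of unity in an algebraic closure of $K$ (that is, a primitive root of unity whose order is the largest divisor of $h$ prime to $p$). Let $$\sqrt{R_S^*}=\{x\in L^* : x^n\in R_S^* \text{ for some integer } n\ge 1\}.$$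 For $a,b\in L^*$, call the equation $ax+by=1$ *$S$-trivial* if there is an integer $n\ge 1$ such that $a^n\in R_S^*$ and $b^n\in R_S^*$. **Theorem.** Let $a,b\in L^*$. If the equation $ax+by=1$ is not $S$-trivial, then it has at most $$\frac{p^{2|S|-2}\left(p^{2|S|-2}+p-2\right)}{p-1}$$ solutions $(x,y)\in\left(\sqrt{R_S^*}\right)^2$. -/

import Mathlib

open scoped nonZeroDivisors WithZero RatFunc

/-- A (non-archimedean) place of a field `K`, given by its normalized discrete valuation, i.e. one
with value group all of `ℤ`. Mathlib writes valuations multiplicatively: the additive conditions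
"the valuation of `x` is `≥ 0`" and "is `= 0`" read `v x ≤ 1` and `v x = 1`. On a finite extension
of `𝔽_p(t)` every place is of this kind, and distinct normalized valuations are distinct places. -/
def Place (K : Type*) [Field K] : Type _ :=
  {v : Valuation K ℤᵐ⁰ // Function.Surjective v}

/-- The ring `R_S` of `S`-integers of `K`. -/
def sIntegers {K : Type*} [Field K] (S : Finset (Place K)) : Subring K where
  carrier := {x | ∀ v : Place K, v ∉ S → v.1 x ≤ 1}
  mul_mem' := fun {x y} hx hy v hv => by
    rw [map_mul]; exact mul_le_one' (hx v hv) (hy v hv)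
  one_mem' := fun v _ => (map_one v.1).le
  add_mem' := fun {x y} hx hy v hv => (v.1.map_add x y).trans (max_le (hx v hv) (hy v hv))
  zero_mem' := fun v _ => by rw [map_zero]; exact zero_le_one
  neg_mem' := fun {x} hx v hv => by rw [Valuation.map_neg]; exact hx v hv

/-- The group `R_S^*` of `S`-units of `K`. -/
def sUnits {K : Type*} [Field K] (S : Finset (Place K)) : Subgroup Kˣ where
  carrier := {x | ∀ v : Place K, v ∉ S → v.1 (x : K) = 1}
  mul_mem' := fun {x y} hx hy v hv => by
    rw [Units.val_mul, map_mul, hx v hv, hy v hv, one_mul]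
  one_mem' := fun v _ => map_one v.1
  inv_mem' := fun {x} hx v hv => by
    rw [Units.val_inv_eq_inv_val, map_inv₀, hx v hv, inv_one]

/-- The group `R_S^*` regarded as a subgroup of `L^*`, for a field extension `L` of `K`. -/
def sUnitsIn {K : Type*} [Field K] (S : Finset (Place K)) (L : Type*) [Field L] [Algebra K L] :
    Subgroup Lˣ :=
  (sUnits S).map (Units.map (algebraMap K L).toMonoidHom)

/-- The radical `√(R_S^*)` of `R_S^*` in `L^*`: the elements of `L^*` having some positive power
in `R_S^*`. -/
def sqrtSUnits {K : Type*} [Field K] (S : Finset (Place K)) (L : Type*) [Field L] [Algebra K L] :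
    Subgroup Lˣ where
  carrier := {x | ∃ n : ℕ, 1 ≤ n ∧ x ^ n ∈ sUnitsIn S L}
  mul_mem' := by
    rintro x y ⟨m, hm, hx⟩ ⟨n, hn, hy⟩
    refine ⟨m * n, Nat.mul_pos hm hn, ?_⟩
    rw [mul_pow, pow_mul x, mul_comm m n, pow_mul y]
    exact mul_mem (pow_mem hx n) (pow_mem hy m)
  one_mem' := ⟨1, le_rfl, by rw [one_pow]; exact one_mem _⟩
  inv_mem' := by
    rintro x ⟨n, hn, hx⟩
    exact ⟨n, hn, by rw [inv_pow]; exact inv_mem hx⟩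

/-- The class number `h` of the ring `R_S`. -/
noncomputable def sClassNumber {K : Type*} [Field K] (S : Finset (Place K)) : ℕ :=
  Nat.card (ClassGroup (sIntegers S))

/-- `L = K(ζ, α₁^{1/h}, …, α_h^{1/h})`, where `h` is the class number of `R_S`, the `𝔞 c` are
ideals of `R_S` representing the ideal classes `c` (one for each class), `α c` is a generator of
the ideal `(𝔞 c) ^ h`, `β c` is a chosen `h`-th root of `α c`, and `ζ` generates the group of
`h`-th roots of unity in an algebraic closure. In characteristic `p` that group has order the
prime-to-`p` part `h / p ^ padicValNat p h` of `h`, so `ζ` is a primitive `h`-th root of unity when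
`p ∤ h`. -/
def IsClassRadicalExtension (p : ℕ) {K : Type*} [Field K] (S : Finset (Place K))
    (L : Type*) [Field L] [Algebra K L] : Prop :=
  ∃ (𝔞 : ClassGroup (sIntegers S) → Ideal (sIntegers S))
    (α : ClassGroup (sIntegers S) → sIntegers S)
    (ζ : L) (β : ClassGroup (sIntegers S) → L),
    (∀ c, ∃ I : (FractionalIdeal (sIntegers S)⁰ (FractionRing (sIntegers S)))ˣ,
      (I : FractionalIdeal (sIntegers S)⁰ (FractionRing (sIntegers S))) = ((𝔞 c : Ideal (sIntegers S)) :
        FractionalIdeal (sIntegers S)⁰ (FractionRing (sIntegers S))) ∧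
        ClassGroup.mk (K := FractionRing (sIntegers S)) I = c) ∧
    (∀ c, 𝔞 c ^ sClassNumber S = Ideal.span {α c}) ∧
    IsPrimitiveRoot ζ (sClassNumber S / p ^ padicValNat p (sClassNumber S)) ∧
    (∀ c, β c ^ sClassNumber S = algebraMap K L (α c : K)) ∧
    IntermediateField.adjoin K (insert ζ (Set.range β)) = ⊤

/-- The equation `a x + b y = 1`, with `a, b ∈ L^*`, is `S`-trivial. -/
def IsSTrivial {K : Type*} [Field K] (S : Finset (Place K)) {L : Type*} [Field L] [Algebra K L]
    (a b : Lˣ) : Prop :=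
  ∃ n : ℕ, 1 ≤ n ∧ a ^ n ∈ sUnitsIn S L ∧ b ^ n ∈ sUnitsIn S L

/-- The solutions `(x, y)` of `a x + b y = 1` with `x, y ∈ √(R_S^*)`. -/
def sqrtSUnitSolutions {K : Type*} [Field K] (S : Finset (Place K)) {L : Type*} [Field L]
    [Algebra K L] (a b : Lˣ) : Set (Lˣ × Lˣ) :=
  {P | P.1 ∈ sqrtSUnits S L ∧ P.2 ∈ sqrtSUnits S L ∧ (a : L) * P.1 + (b : L) * P.2 = 1}

/-! Write Γ for `sqrtSUnits S L` and Q for p^(2|S|-2). The proof gives the bound 2Q - 1, which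
implies the stated one because (Q - 1)(Q + 1 - p) ≥ 0.

An S-unit integral at every place of S is a root of unity, so |S| S-units are dependent modulo
torsion. Torsion is p-divisible in characteristic p, hence Γ/Γ^p has order at most p^(|S|-1)
(`card_sqrtSUnits_quotient_le`).

The count is `card_le_of_forall_solution`, for L finite over K. Given finitely many solutions, let m
be maximal such that ax is a p^m-th power for one of them, (x₀, y₀); m exists because infinitely
p-divisible elements lie in Γ while a, b are not both in Γ. Then by₀ = 1 - ax₀ is a p^m-th power
too; write ax₀ = α^(p^m), by₀ = β^(p^m). Each solution is (u^(p^n) x₀, v^(p^n) y₀) with u, v in Γ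
and n ≤ m maximal, and α^(p^(m-n)) u + β^(p^(m-n)) v = 1. The classes of u, v modulo Γ^p, together
with whether n = m, determine the solution; for n < m the two classes are not both trivial. This
leaves 2Q - 1 possibilities.

For general L, finitely many solutions already live over a finite extension of K
(`card_solutions_le`). -/

/-! ### Places, poles and roots of unity -/

/-- A nontrivial valuation with values in `ℤᵐ⁰` is equivalent to a surjective one. -/
theorem Valuation.exists_surjective_isEquiv {E : Type*} [Field E] (v : Valuation E ℤᵐ⁰)
    [v.IsNontrivial] :
    ∃ w : Valuation E ℤᵐ⁰, Function.Surjective w ∧ v.IsEquiv w := by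
  have : v.IsRankOneDiscrete := inferInstance
  let e := Valuation.IsRankOneDiscrete.valueGroup₀_equiv_withZeroMulInt v
  refine ⟨v.restrict.map (.ofClass e)
    (OrderMonoidIso.strictMono e).monotone, ?_, ?_⟩
  · intro z
    obtain ⟨g, rfl⟩ := e.surjective z
    obtain ⟨x, rfl⟩ := MonoidWithZeroHom.ValueGroup₀.restrict₀_surjective (.ofClass v) g
    exact ⟨x, rfl⟩
  · intro x y
    rw [← v.restrict_le_iff]
    exact (OrderMonoidIso.strictMono e).le_iff_le.symm

/-- Over the separable closure M of K₀ in E, the integral closure of A is Dedekind and some prime of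
it contains a. An iterated Frobenius maps E into M, so the prime's valuation pulls back to E and can
then be normalized. -/
theorem exists_place_lt_one {A K₀ E : Type*} [CommRing A] [IsDedekindDomain A] [Field K₀]
    [Algebra A K₀] [IsFractionRing A K₀] [Field E] [Algebra K₀ E] [Algebra A E]
    [IsScalarTower A K₀ E] [FiniteDimensional K₀ E] {a : A} (ha : a ≠ 0) (hu : ¬ IsUnit a) :
    ∃ v : Place E, v.1 (algebraMap A E a) < 1 := by
  let M := separableClosure K₀ E
  let B := integralClosure A M
  have hA : Function.Injective (algebraMap A M) := by
    rw [IsScalarTower.algebraMap_eq A K₀ M]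
    exact (algebraMap K₀ M).injective.comp (IsFractionRing.injective A K₀)
  have : FaithfulSMul A M := (faithfulSMul_iff_algebraMap_injective A M).2 hA
  have : IsScalarTower A M E := IsScalarTower.of_algebraMap_eq fun x => by
    rw [IsScalarTower.algebraMap_apply A K₀ E, IsScalarTower.algebraMap_apply A K₀ M,
      ← IsScalarTower.algebraMap_apply K₀ M E]
  have : IsDedekindDomain B := integralClosure.isDedekindDomain A K₀ M
  have : IsFractionRing B M := integralClosure.isFractionRing_of_finite_extension K₀ M
  have : IsPurelyInseparable.HasExponent M E := inferInstance
  have hb : ¬ IsUnit (algebraMap A B a) := fun h => hu (isUnit_of_map_unit (algebraMap A B) a h)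
  obtain ⟨P, hP, haP⟩ := exists_max_ideal_of_mem_nonunits hb
  have hb0 : algebraMap A B a ≠ 0 := by
    intro h
    apply ha
    apply hA
    have := congrArg (algebraMap B M) h
    simpa [← IsScalarTower.algebraMap_apply] using this
  let 𝔓 : IsDedekindDomain.HeightOneSpectrum B :=
    ⟨P, hP.isPrime, fun h => hb0 (by simpa [h] using haP)⟩
  let q := ringExpChar M
  let f : E →+* M := IsPurelyInseparable.iterateFrobenius M E q le_rfl
  have hf : (𝔓.valuation M).comap f (algebraMap A E a) < 1 := by
    have : f (algebraMap A E a) = algebraMap B M (algebraMap A B a) ^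
        q ^ IsPurelyInseparable.exponent M E := by
      apply (algebraMap M E).injective
      rw [IsPurelyInseparable.algebraMap_iterateFrobenius, map_pow,
        ← IsScalarTower.algebraMap_apply A B M, ← IsScalarTower.algebraMap_apply A M E]
    rw [Valuation.comap_apply, this, map_pow]
    refine pow_lt_one₀ zero_le ((𝔓.valuation_lt_one_iff_mem _).2 haP) ?_
    exact (pow_pos (expChar_pos M q) _).ne'
  have : ((𝔓.valuation M).comap f).IsNontrivial :=
    ⟨algebraMap A E a, (Valuation.ne_zero_iff _).2 (by
      rw [IsScalarTower.algebraMap_apply A M E, Ne, map_eq_zero]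
      exact fun h => ha (hA (by simpa using h))), hf.ne⟩
  obtain ⟨w, hw, he⟩ := ((𝔓.valuation M).comap f).exists_surjective_isEquiv
  exact ⟨⟨w, hw⟩, he.lt_one_iff_lt_one.1 hf⟩

-- A pole of x is a zero of y = 1/x, and y is a nonzero nonunit of the polynomial ring F[y], over
-- whose fraction field E is finite.
open IntermediateField algebraAdjoinAdjoin in
theorem exists_place_one_lt {F E : Type*} [Field F] [Field E] [Algebra F⟮X⟯ E]
    [FiniteDimensional F⟮X⟯ E] [Algebra F E] [IsScalarTower F F⟮X⟯ E] {x : E}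
    (hx : Transcendental F x) : ∃ v : Place E, 1 < v.1 x := by
  have hx0 : x ≠ 0 := by rintro rfl; exact hx isAlgebraic_zero
  obtain ⟨y, rfl⟩ : ∃ y : E, x = y⁻¹ := ⟨x⁻¹, (inv_inv x).symm⟩
  have hy0 : y ≠ 0 := by simpa using hx0
  have hy : Transcendental F y := fun h => hx h.inv
  have : FiniteDimensional F⟮y⟯ E := FunctionField.finiteDimensional_of_adjoin_transcendental hy
  let e := Polynomial.algEquivOfTranscendental F y hy
  have : IsPrincipalIdealRing (Algebra.adjoin F {y}) :=
    IsPrincipalIdealRing.of_surjective e.toRingEquiv e.surjective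
  have he : algebraMap (Algebra.adjoin F {y}) E (e Polynomial.X) = y := by
    simp [e]
  obtain ⟨v, hv⟩ := exists_place_lt_one (A := Algebra.adjoin F {y}) (K₀ := F⟮y⟯) (E := E)
    (a := e Polynomial.X) (by simp) (by
      rw [MulEquiv.isUnit_map]; exact Polynomial.not_isUnit_X)
  rw [he] at hv
  exact ⟨v, by rwa [map_inv₀, one_lt_inv₀ (by simpa [zero_lt_iff] using hy0)]⟩

/-- An element of a function field over a finite prime field that is integral at all places is
zero or a root of unity. -/
theorem exists_pow_eq_one_of_forall_place_le_one {p : ℕ} [Fact p.Prime] {E : Type*} [Field E]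
    [Algebra (ZMod p)⟮X⟯ E] [FiniteDimensional (ZMod p)⟮X⟯ E] {x : E} (hx0 : x ≠ 0)
    (hx : ∀ v : Place E, v.1 x ≤ 1) : ∃ n : ℕ, 1 ≤ n ∧ x ^ n = 1 := by
  let _ : Algebra (ZMod p) E :=
    ((algebraMap (ZMod p)⟮X⟯ E).comp (algebraMap (ZMod p) (ZMod p)⟮X⟯)).toAlgebra
  have : IsScalarTower (ZMod p) (ZMod p)⟮X⟯ E := IsScalarTower.of_algebraMap_eq fun _ => rfl
  have halg : IsAlgebraic (ZMod p) x := by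
    by_contra h
    obtain ⟨v, hv⟩ := exists_place_one_lt h
    exact (hx v).not_gt hv
  have : FiniteDimensional (ZMod p) (IntermediateField.adjoin (ZMod p) {x}) :=
    IntermediateField.adjoin.finiteDimensional halg.isIntegral
  have : Finite (IntermediateField.adjoin (ZMod p) {x}) := Module.finite_of_finite (ZMod p)
  obtain ⟨n, hn, h⟩ := isOfFinOrder_iff_pow_eq_one.1 (isOfFinOrder_of_finite
    (Units.mk0 (IntermediateField.AdjoinSimple.gen (ZMod p) x)
      fun h => hx0 (by simpa using congrArg (algebraMap _ E) h)))
  refine ⟨n, hn, ?_⟩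
  have := congrArg (fun u => algebraMap _ E (Units.val u)) h
  simpa using this

/-- A root of unity in a field of characteristic `p` is a `p`-th power of one of its powers. -/
theorem exists_pow_pow_eq_of_isOfFinOrder {p : ℕ} [hp : Fact p.Prime] {L : Type*} [Field L]
    [CharP L p] {z : Lˣ} (hz : IsOfFinOrder z) : ∃ m : ℕ, (z ^ m) ^ p = z := by
  -- Frobenius is injective, so there is no element of order p.
  have hcop : p.Coprime (orderOf z) := by
    rw [hp.out.coprime_iff_not_dvd]
    rintro ⟨k, hk⟩
    have hpos := hz.orderOf_pos
    have hk0 : 0 < k := Nat.pos_of_ne_zero (by rintro rfl; simp [hk] at hpos)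
    have h1 : (z ^ k) ^ p = 1 := by rw [← pow_mul, mul_comm, ← hk, pow_orderOf_eq_one]
    have h2 : z ^ k = 1 := by
      ext
      apply frobenius_inj L p
      simpa [frobenius_def] using congrArg Units.val h1
    have := Nat.le_of_dvd hk0 (orderOf_dvd_of_pow_eq_one h2)
    rw [hk] at this
    nlinarith [hp.out.two_le]
  obtain ⟨m, hm⟩ := exists_pow_eq_self_of_coprime hcop
  exact ⟨m, by rw [← pow_mul, mul_comm, pow_mul, hm]⟩

/-! ### Multiplicative dependence of S-units -/

section

variable {K : Type*} [Field K] {S : Finset (Place K)}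

theorem isOfFinOrder_of_mem_sUnits (p : ℕ) [hp : Fact p.Prime] [Algebra (ZMod p)⟮X⟯ K]
    [FiniteDimensional (ZMod p)⟮X⟯ K] {u : Kˣ} (hu : u ∈ sUnits S)
    (h : ∀ v ∈ S, v.1 (u : K) ≤ 1) : IsOfFinOrder u := by
  obtain ⟨n, hn, h⟩ := exists_pow_eq_one_of_forall_place_le_one (p := p) u.ne_zero fun v => by
    by_cases hv : v ∈ S
    · exact h v hv
    · exact (hu v hv).le
  exact isOfFinOrder_iff_pow_eq_one.2 ⟨n, hn, by ext; simpa using h⟩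

theorem log_place_prod_zpow {ι : Type*} [Fintype ι] (v : Place K) (u : ι → Kˣ) (e : ι → ℤ) :
    WithZero.log (v.1 ((∏ i, u i ^ e i : Kˣ) : K)) = ∑ i, e i * WithZero.log (v.1 (u i : K)) := by
  have hv (x : Kˣ) : v.1 (x : K) ≠ 0 := (Valuation.ne_zero_iff _).2 x.ne_zero
  let φ : Kˣ →* Multiplicative ℤ :=
    { toFun x := .ofAdd (WithZero.log (v.1 (x : K)))
      map_one' := by simp
      map_mul' x y := by simp [WithZero.log_mul (hv x) (hv y)] }
  have := congrArg Multiplicative.toAdd (map_prod φ (fun i => u i ^ e i) Finset.univ)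
  rw [toAdd_prod] at this
  change WithZero.log _ = _ at this
  rw [this]
  refine Finset.sum_congr rfl fun i _ => ?_
  rw [map_zpow, toAdd_zpow, smul_eq_mul]
  rfl

/-- As many `S`-units as there are places in `S` are multiplicatively dependent modulo torsion. -/
theorem exists_isOfFinOrder_prod_zpow (p : ℕ) [hp : Fact p.Prime] [Algebra (ZMod p)⟮X⟯ K]
    [FiniteDimensional (ZMod p)⟮X⟯ K]
    (hS : S.Nonempty) {u : S → Kˣ} (hu : ∀ i, u i ∈ sUnits S) :
    ∃ e : S → ℤ, e ≠ 0 ∧ IsOfFinOrder (∏ i, u i ^ e i) := by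
  classical
  let M : Matrix S S ℤ := fun i v => WithZero.log (v.1.1 (u i : K))
  have hmem (e : S → ℤ) : ∏ i, u i ^ e i ∈ sUnits S :=
    Subgroup.prod_mem _ fun i _ => Subgroup.zpow_mem _ (hu i) _
  have hlog (e : S → ℤ) (v : S) : WithZero.log (v.1.1 ((∏ i, u i ^ e i : Kˣ) : K)) =
      (Matrix.vecMul e M) v := by
    rw [log_place_prod_zpow]; rfl
  have hne (x : Kˣ) (v : Place K) : v.1 (x : K) ≠ 0 := (Valuation.ne_zero_iff _).2 x.ne_zero
  have htors (e : S → ℤ) (h : ∀ v, (Matrix.vecMul e M) v ≤ 0) :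
      IsOfFinOrder (∏ i, u i ^ e i) := by
    refine isOfFinOrder_of_mem_sUnits p (hmem e) fun v hv => ?_
    rw [← WithZero.log_le_log (hne _ v) one_ne_zero, WithZero.log_one, hlog e ⟨v, hv⟩]
    exact h _
  by_cases hdet : M.det = 0
  · obtain ⟨e, he, h⟩ := Matrix.exists_vecMul_eq_zero_iff.2 hdet
    exact ⟨e, he, htors e fun v => by simp [h]⟩
  · exfalso
    -- With a nonzero determinant, the adjugate yields an S-unit with the same negative log at every
    -- place of S. Being integral everywhere it is torsion, which is absurd; this takes the place of
    -- the product formula.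
    obtain ⟨c, hc, hc0⟩ : ∃ c : ℤ, c * M.det < 0 ∧ c ≠ 0 := by
      rcases lt_or_gt_of_ne hdet with h | h
      · exact ⟨1, by linarith, by norm_num⟩
      · exact ⟨-1, by linarith, by norm_num⟩
    let e : S → ℤ := Matrix.vecMul (fun _ => c) M.adjugate
    have he (v) : (Matrix.vecMul e M) v = c * M.det := by
      rw [Matrix.vecMul_vecMul, Matrix.adjugate_mul, Matrix.vecMul_smul, Matrix.vecMul_one]
      simp [mul_comm]
    obtain ⟨v, hv⟩ := hS
    obtain ⟨n, hn, h1⟩ := isOfFinOrder_iff_pow_eq_one.1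
      (htors e fun v => (he v).trans_le hc.le)
    have h2 : WithZero.log (v.1 ((∏ i, u i ^ e i : Kˣ) : K) ^ n) = 0 := by
      rw [← map_pow, ← Units.val_pow_eq_pow_val, h1]; simp
    rw [WithZero.log_pow, hlog e ⟨v, hv⟩, he] at h2
    rcases smul_eq_zero.1 h2 with h | h
    · omega
    · exact hc.ne h

variable {L : Type*} [Field L] [Algebra K L]

theorem mem_sqrtSUnits_of_pow_mem {x : Lˣ} {n : ℕ} (hn : 1 ≤ n) (h : x ^ n ∈ sqrtSUnits S L) :
    x ∈ sqrtSUnits S L := by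
  obtain ⟨m, hm, h⟩ := h
  exact ⟨n * m, Nat.mul_pos hn hm, by rwa [pow_mul]⟩

/-- As many elements of `√(R_S^*)` as there are places in `S` are multiplicatively dependent
modulo `p`-th powers. -/
theorem exists_prod_zpow_eq_pow (p : ℕ) [hp : Fact p.Prime] [Algebra (ZMod p)⟮X⟯ K]
    [FiniteDimensional (ZMod p)⟮X⟯ K] [CharP L p]
    (hS : S.Nonempty) {g : S → Lˣ}
    (hg : ∀ i, g i ∈ sqrtSUnits S L) :
    ∃ e : S → ℤ, (∃ i, ¬ (p : ℤ) ∣ e i) ∧ ∃ w ∈ sqrtSUnits S L, ∏ i, g i ^ e i = w ^ p := by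
  choose n hn u hu hgu using hg
  obtain ⟨e, he, htors⟩ := exists_isOfFinOrder_prod_zpow p hS hu
  obtain ⟨j, hj⟩ := Function.ne_iff.1 he
  -- Dividing the exponents n i * e i by their gcd keeps the product torsion and leaves some
  -- exponent prime to p.
  obtain ⟨c, hc, hgcd⟩ := Finset.extract_gcd (s := Finset.univ) (fun i => (n i : ℤ) * e i)
    ⟨j, Finset.mem_univ _⟩
  set d := Finset.univ.gcd (fun i => (n i : ℤ) * e i)
  have hd : d ≠ 0 := by
    intro h
    have := hc j (Finset.mem_univ _)
    rw [h, zero_mul] at this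
    rcases mul_eq_zero.1 this with h | h
    · have := hn j; omega
    · exact hj h
  have hfin : IsOfFinOrder (∏ i, g i ^ c i) := by
    have h1 : (∏ i, g i ^ c i) ^ d =
        Units.map (algebraMap K L).toMonoidHom (∏ i, u i ^ e i) := by
      rw [map_prod, ← Finset.prod_zpow]
      refine Finset.prod_congr rfl fun i hi => ?_
      rw [← zpow_mul, mul_comm, ← hc i hi, zpow_mul, zpow_natCast, map_zpow, hgu]
    have h2 : IsOfFinOrder ((∏ i, g i ^ c i) ^ d) := by
      rw [h1]; exact MonoidHom.isOfFinOrder _ htors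
    rcases Int.natAbs_eq d with h | h
    · rw [h, zpow_natCast] at h2
      exact (isOfFinOrder_pow.1 h2).resolve_right (by simpa using hd)
    · rw [h, zpow_neg, zpow_natCast, isOfFinOrder_inv_iff] at h2
      exact (isOfFinOrder_pow.1 h2).resolve_right (by simpa using hd)
  obtain ⟨m, hm⟩ := exists_pow_pow_eq_of_isOfFinOrder (p := p) hfin
  refine ⟨c, ?_, _, ?_, hm.symm⟩
  · by_contra! h
    have : (p : ℤ) ∣ 1 := by rw [← hgcd]; exact Finset.dvd_gcd fun i _ => h i
    exact hp.out.one_lt.ne' (by simpa using Int.natAbs_dvd_natAbs.2 this)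
  · have hg (i) : g i ∈ sqrtSUnits S L := ⟨n i, hn i, _, hu i, hgu i⟩
    exact Subgroup.pow_mem _ (Subgroup.prod_mem _ fun i _ => Subgroup.zpow_mem _ (hg i) _) _

end

/-! ### The index of the p-th powers -/

theorem ZMod.card_le_pow_of_rank_le {V : Type*} {p n : ℕ} [hp : Fact p.Prime] [AddCommGroup V]
    [Module (ZMod p) V] (hrank : Module.rank (ZMod p) V ≤ n) : Finite V ∧ Nat.card V ≤ p ^ n := by
  have : Module.Finite (ZMod p) V := by
    rw [← Module.rank_lt_aleph0_iff]
    exact hrank.trans_lt Cardinal.natCast_lt_aleph0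
  refine ⟨Module.finite_of_finite (ZMod p), ?_⟩
  rw [Module.natCard_eq_pow_finrank (K := ZMod p), Nat.card_zmod]
  exact Nat.pow_le_pow_right hp.out.pos (Module.finrank_le_of_rank_le hrank)

/-- A quotient, killed by `p`, of an abelian group in which any `n` elements are dependent modulo
the kernel has order at most `p ^ (n - 1)`. -/
theorem CommGroup.card_le_pow_of_dependent {G Q : Type*} [CommGroup G] [CommGroup Q] (π : G →* Q)
    (hπ : Function.Surjective π) (p : ℕ) [hp : Fact p.Prime] (hQ : ∀ g, π (g ^ p) = 1)
    {ι : Type*} [Fintype ι]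
    (h : ∀ g : ι → G, ∃ e : ι → ℤ, (∃ i, ¬ (p : ℤ) ∣ e i) ∧ π (∏ i, g i ^ e i) = 1) :
    Finite Q ∧ Nat.card Q ≤ p ^ (Fintype.card ι - 1) := by
  let _ : Module (ZMod p) (Additive Q) := AddCommGroup.zmodModule fun x => by
    obtain ⟨g, hg⟩ := hπ (Additive.toMul x)
    apply Additive.toMul.injective
    rw [toMul_nsmul, ← hg, toMul_zero, ← map_pow, hQ]
  refine ZMod.card_le_pow_of_rank_le (V := Additive Q) (rank_le fun s hs => ?_)
  by_contra! hlt
  have hle : Fintype.card ι ≤ Fintype.card s := by simp; omega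
  obtain ⟨f⟩ := Function.Embedding.nonempty_of_card_le hle
  choose g hg using fun i => hπ (Additive.toMul (f i : Additive Q))
  obtain ⟨e, ⟨i, hi⟩, he⟩ := h g
  apply hi
  rw [← ZMod.intCast_zmod_eq_zero_iff_dvd]
  refine Fintype.linearIndependent_iff.1 (hs.comp f f.injective) (fun i => (e i : ZMod p)) ?_ i
  simp only [Function.comp_apply, Int.cast_smul_eq_zsmul]
  simp only [map_prod, map_zpow, hg] at he
  exact he

/-- The index of the `p`-th powers in `√(R_S^*)` is at most `p ^ (|S| - 1)`. -/
theorem card_sqrtSUnits_quotient_le {K : Type*} [Field K] {S : Finset (Place K)} {L : Type*}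
    [Field L] [Algebra K L] (p : ℕ) [Fact p.Prime] [Algebra (ZMod p)⟮X⟯ K]
    [FiniteDimensional (ZMod p)⟮X⟯ K] [CharP L p] (hS : S.Nonempty) :
    Finite (sqrtSUnits S L ⧸ (powMonoidHom p : sqrtSUnits S L →* sqrtSUnits S L).range) ∧
      Nat.card (sqrtSUnits S L ⧸ (powMonoidHom p : sqrtSUnits S L →* sqrtSUnits S L).range) ≤
        p ^ (S.card - 1) := by
  rw [← Fintype.card_coe S]
  refine CommGroup.card_le_pow_of_dependent (QuotientGroup.mk' _)
    (QuotientGroup.mk'_surjective _) p (fun g => ?_) fun g => ?_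
  · exact (QuotientGroup.eq_one_iff _).2 ⟨g, rfl⟩
  · obtain ⟨e, he, w, hw, h⟩ := exists_prod_zpow_eq_pow p (L := L) hS
      (g := fun i => (g i : Lˣ)) fun i => (g i).2
    refine ⟨e, he, (QuotientGroup.eq_one_iff _).2 ⟨⟨w, hw⟩, ?_⟩⟩
    ext
    simp [← h]

/-! ### Counting solutions by classes modulo p-th powers -/

section

variable {p : ℕ} [hp : Fact p.Prime] {L : Type*} [Field L] [CharP L p]

/-- The coefficients of `1` in terms of `x` and `y` over the field of `p`-th powers are unique,
unless `x` and `y` are both `p`-th powers. -/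
theorem eq_and_eq_of_pow_mul_add_pow_mul_eq_one {x y : L} (hxy : ¬ ∃ w z : L, w ^ p = x ∧ z ^ p = y)
    {f g f' g' : L} (hf : f ≠ 0) (h : f ^ p * x + g ^ p * y = 1)
    (h' : f' ^ p * x + g' ^ p * y = 1) : f' = f ∧ g' = g := by
  -- Otherwise Cramer's rule over the field of p-th powers exhibits x and y as p-th powers.
  have hD : f * g' - f' * g = 0 := by
    by_contra hD
    refine hxy ⟨(g' - g) / (f * g' - f' * g), (f - f') / (f * g' - f' * g), ?_, ?_⟩
    · rw [div_pow, div_eq_iff (pow_ne_zero p hD)]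
      simp only [sub_pow_char, mul_pow]
      linear_combination g ^ p * h' - g' ^ p * h
    · rw [div_pow, div_eq_iff (pow_ne_zero p hD)]
      simp only [sub_pow_char, mul_pow]
      linear_combination f' ^ p * h - f ^ p * h'
  have hDp : f ^ p * g' ^ p = f' ^ p * g ^ p := by rw [← mul_pow, sub_eq_zero.1 hD, mul_pow]
  have hff : f' = f := by
    apply frobenius_inj L p
    simp only [frobenius_def]
    linear_combination f ^ p * h' - f' ^ p * h - y * hDp
  refine ⟨hff, mul_left_cancel₀ hf ?_⟩
  rw [hff] at hD
  exact sub_eq_zero.1 hD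

theorem Subgroup.mem_of_pow_eq_pow_mul {G : Type*} [CommGroup G] {Γ : Subgroup G}
    (hrad : ∀ (x : G) (n : ℕ), 1 ≤ n → x ^ n ∈ Γ → x ∈ Γ) {x w : G} (hw : w ∈ Γ) {i j : ℕ}
    (hij : i ≠ j) (h : x ^ i = x ^ j * w) : x ∈ Γ := by
  have h1 : x ^ ((i : ℤ) - j) ∈ Γ := by
    rw [zpow_sub, zpow_natCast, zpow_natCast, h, mul_comm, inv_mul_cancel_left]; exact hw
  apply hrad x ((i : ℤ) - j).natAbs (by omega)
  rcases Int.natAbs_eq ((i : ℤ) - j) with e | e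
  · rw [e, zpow_natCast] at h1; exact h1
  · rw [e, zpow_neg, zpow_natCast] at h1; exact (Subgroup.inv_mem_iff _).1 h1

/-- If the radical group `Γ` contains all infinitely `p`-divisible elements and its `p`-th powers
have index at most `q`, then a nontrivial equation `a x + b y = 1` has at most `2 q ^ 2 - 1`
solutions in `Γ`. -/
theorem card_le_of_forall_solution {Γ : Subgroup Lˣ}
    (hrad : ∀ (x : Lˣ) (n : ℕ), 1 ≤ n → x ^ n ∈ Γ → x ∈ Γ)
    (hdiv : ∀ x : Lˣ, (∀ n : ℕ, ∃ y : Lˣ, y ^ p ^ n = x) → x ∈ Γ)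
    [Finite (Γ ⧸ (powMonoidHom p : Γ →* Γ).range)] {a b : Lˣ} (hab : ¬ (a ∈ Γ ∧ b ∈ Γ))
    (T : Finset (Lˣ × Lˣ))
    (hT : ∀ P ∈ T, P.1 ∈ Γ ∧ P.2 ∈ Γ ∧ (a : L) * P.1 + (b : L) * P.2 = 1) :
    T.card + 1 ≤ 2 * Nat.card (Γ ⧸ (powMonoidHom p : Γ →* Γ).range) ^ 2 := by
  classical
  have : Fintype (Γ ⧸ (powMonoidHom p : Γ →* Γ).range) := Fintype.ofFinite _
  rcases T.eq_empty_or_nonempty with rfl | hne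
  · have : 0 < Nat.card (Γ ⧸ (powMonoidHom p : Γ →* Γ).range) := Nat.card_pos
    have := pow_pos this 2
    simp only [Finset.card_empty]; omega
  -- If c = y^(p^n), then d = 1 - c = (1 - y)^(p^n).
  have hroot (c d : Lˣ) (hcd : (c : L) + d = 1) (n : ℕ) (y : Lˣ) (hy : y ^ p ^ n = c) :
      ∃ z : Lˣ, z ^ p ^ n = d := by
    have h1 : (1 - (y : L)) ^ p ^ n = d := by
      rw [sub_pow_char_pow, one_pow, ← Units.val_pow_eq_pow_val, hy, ← hcd]; ring
    have h2 : (1 - (y : L)) ≠ 0 := by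
      intro h0
      rw [h0, zero_pow (pow_pos hp.out.pos n).ne'] at h1
      exact d.ne_zero h1.symm
    exact ⟨Units.mk0 _ h2, by ext; simpa using h1⟩
  have hex : ∀ P ∈ T, ∃ N : ℕ, ¬ ∃ y : Lˣ, y ^ p ^ N = a * P.1 := by
    intro P hP
    by_contra! h
    obtain ⟨h1, h2, h3⟩ := hT P hP
    refine hab ⟨(Subgroup.mul_mem_cancel_right _ h1).1 (hdiv _ h),
      (Subgroup.mul_mem_cancel_right _ h2).1 (hdiv _ fun n => ?_)⟩
    obtain ⟨y, hy⟩ := h n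
    exact hroot (a * P.1) (b * P.2) (by simpa using h3) n y hy
  obtain ⟨m, Q, hQ, ⟨α, hα⟩, hm⟩ : ∃ m : ℕ, ∃ Q ∈ T, (∃ y : Lˣ, y ^ p ^ m = a * Q.1) ∧
      ∀ P ∈ T, ¬ ∃ y : Lˣ, y ^ p ^ (m + 1) = a * P.1 := by
    have hmono : ∀ P : Lˣ × Lˣ, ∀ i j : ℕ, i ≤ j → (∃ y : Lˣ, y ^ p ^ j = a * P.1) →
        ∃ y : Lˣ, y ^ p ^ i = a * P.1 := by
      rintro P i j hij ⟨y, hy⟩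
      exact ⟨y ^ p ^ (j - i), by rw [← pow_mul, ← pow_add, Nat.sub_add_cancel hij, hy]⟩
    choose! N hN using hex
    have hbd : ∃ N : ℕ, ∀ P ∈ T, ¬ ∃ y : Lˣ, y ^ p ^ N = a * P.1 :=
      ⟨T.sup N, fun P hP h => hN P hP (hmono P _ _ (Finset.le_sup hP) h)⟩
    have hpos : Nat.find hbd ≠ 0 := by
      intro h0
      obtain ⟨P, hP⟩ := hne
      exact (h0 ▸ Nat.find_spec hbd) P hP ⟨a * P.1, by simp⟩
    obtain ⟨m, hm⟩ := Nat.exists_eq_succ_of_ne_zero hpos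
    have := Nat.find_min hbd (m := m) (by omega)
    push Not at this
    obtain ⟨Q, hQ, h⟩ := this
    exact ⟨m, Q, hQ, h, by have := Nat.find_spec hbd; rwa [hm] at this⟩
  obtain ⟨hQ1, hQ2, hQ3⟩ := hT Q hQ
  obtain ⟨β, hβ⟩ := hroot (a * Q.1) (b * Q.2) (by simpa using hQ3) m α hα
  have hnuv : ∀ P ∈ T, ∃ (n : ℕ) (u v : Γ), n ≤ m ∧ (u : Lˣ) ^ p ^ n * Q.1 = P.1 ∧
      (v : Lˣ) ^ p ^ n * Q.2 = P.2 ∧ (n < m → ¬ ∃ w z : Lˣ, w ^ p = u ∧ z ^ p = v) := by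
    intro P hP
    obtain ⟨hP1, hP2, -⟩ := hT P hP
    let R : ℕ → Prop := fun n => ∃ u v : Γ, (u : Lˣ) ^ p ^ n * Q.1 = P.1 ∧
      (v : Lˣ) ^ p ^ n * Q.2 = P.2
    have h0 : R 0 := ⟨⟨P.1 * Q.1⁻¹, mul_mem hP1 (inv_mem hQ1)⟩,
      ⟨P.2 * Q.2⁻¹, mul_mem hP2 (inv_mem hQ2)⟩, by simp, by simp⟩
    obtain ⟨u, v, hu, hv⟩ := Nat.findGreatest_spec (Nat.zero_le m) h0
    refine ⟨Nat.findGreatest R m, u, v, Nat.findGreatest_le m, hu, hv, ?_⟩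
    rintro hlt ⟨w, z, hw, hz⟩
    refine Nat.findGreatest_is_greatest (Nat.lt_succ_self _) hlt
      ⟨⟨w, hrad w p hp.out.one_le (hw ▸ u.2)⟩, ⟨z, hrad z p hp.out.one_le (hz ▸ v.2)⟩, ?_, ?_⟩
    · change w ^ p ^ (_ + 1) * _ = _
      rw [← hu, ← hw, ← pow_mul, ← pow_succ']
    · change z ^ p ^ (_ + 1) * _ = _
      rw [← hv, ← hz, ← pow_mul, ← pow_succ']
  choose! n u v hnm hu hv hlt using hnuv
  -- This is the p^n-th root of the equation a P.1 + b P.2 = 1.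
  have heq : ∀ P ∈ T, (α : L) ^ p ^ (m - n P) * (u P : Lˣ) + (β : L) ^ p ^ (m - n P) * (v P : Lˣ) =
      1 := by
    intro P hP
    apply iterateFrobenius_inj L p (n P)
    simp only [iterateFrobenius_def, map_add, map_mul, map_pow, map_one]
    rw [← pow_mul, ← pow_mul, ← pow_add, Nat.add_sub_cancel' (hnm P hP), ← (hT P hP).2.2, ← hu P hP, ← hv P hP]
    have e1 := congrArg Units.val hα
    have e2 := congrArg Units.val hβ
    push_cast at e1 e2 ⊢
    rw [e1, e2]; ring
  have hext : ∀ P ∈ T, ∀ P' ∈ T, n P = n P' → u P = u P' → v P = v P' → P = P' := by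
    intro P hP P' hP' h1 h2 h3
    ext1
    · rw [← hu P hP, ← hu P' hP', h1, h2]
    · rw [← hv P hP, ← hv P' hP', h1, h3]
  let κ : Lˣ × Lˣ → Bool × (Γ ⧸ (powMonoidHom p : Γ →* Γ).range) ×
      (Γ ⧸ (powMonoidHom p : Γ →* Γ).range) := fun P => (decide (n P = m), ↑(u P), ↑(v P))
  -- If u and v were both p-th powers with n < m, then n could be increased. The missed value
  -- accounts for the -1 in the bound.
  have hmiss : ∀ P ∈ T, κ P ≠ (false, 1, 1) := by
    intro P hP h
    simp only [κ, Prod.mk.injEq, decide_eq_false_iff_not, QuotientGroup.eq_one_iff] at h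
    obtain ⟨h1, ⟨w, hw⟩, ⟨z, hz⟩⟩ := h
    exact hlt P hP (lt_of_le_of_ne (hnm P hP) h1) ⟨w, z, by rw [← hw]; rfl, by rw [← hz]; rfl⟩
  have hinj : Set.InjOn κ T := by
    intro P hP P' hP' h
    simp only [κ, Prod.mk.injEq, decide_eq_decide, QuotientGroup.eq] at h
    obtain ⟨h1, ⟨w, hw⟩, ⟨z, hz⟩⟩ := h
    have huw : u P' = u P * w ^ p := by rw [← inv_mul_eq_iff_eq_mul]; exact hw.symm
    have hvz : v P' = v P * z ^ p := by rw [← inv_mul_eq_iff_eq_mul]; exact hz.symm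
    have e := heq P hP
    have e' := heq P' hP'
    rw [huw, hvz] at e'
    push_cast at e'
    by_cases hn : n P = m
    · have hn' := h1.1 hn
      rw [hn, Nat.sub_self, pow_zero, pow_one, pow_one] at e
      rw [hn', Nat.sub_self, pow_zero, pow_one, pow_one] at e'
      -- If w ≠ z, solving the two equations makes αu a p-th power, so that a P.1 = (αu)^(p^m) is a
      -- p^(m+1)-th power, against the choice of m.
      have hwz : ((w : Lˣ) : L) = (z : Lˣ) := by
        by_contra hne
        have hd : ((w : Lˣ) : L) - (z : Lˣ) ≠ 0 := sub_ne_zero.2 hne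
        have hy : ((1 - (z : Lˣ)) / ((w : Lˣ) - (z : Lˣ)) : L) ^ p = α * (u P : Lˣ) := by
          rw [div_pow, div_eq_iff (pow_ne_zero p hd), sub_pow_char, sub_pow_char, one_pow]
          linear_combination ((z : Lˣ) : L) ^ p * e - e'
        have hy0 : ((1 - (z : Lˣ)) / ((w : Lˣ) - (z : Lˣ)) : L) ≠ 0 := by
          intro h0
          rw [h0, zero_pow hp.out.ne_zero] at hy
          exact (α * (u P : Lˣ)).ne_zero (by simpa using hy.symm)
        have hy' : Units.mk0 _ hy0 ^ p = α * (u P : Lˣ) := by ext; simpa using hy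
        refine hm P hP ⟨Units.mk0 _ hy0, ?_⟩
        rw [pow_succ', pow_mul, hy', mul_pow, hα, ← hu P hP, hn, mul_assoc, mul_comm Q.1]
      have hwp : ((w : Lˣ) : L) ^ p = 1 := by
        rw [← hwz] at e'
        linear_combination e' - ((w : Lˣ) : L) ^ p * e
      have hw1 : w = 1 := by
        ext
        apply frobenius_inj L p
        simpa [frobenius_def] using hwp
      have hz1 : z = 1 := by
        ext
        rw [← hwz, hw1]
      exact hext P hP P' hP' (hn.trans hn'.symm) (by simp [huw, hw1]) (by simp [hvz, hz1])
    · have hn' := fun h => hn (h1.2 h)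
      have hlt1 := lt_of_le_of_ne (hnm P hP) hn
      have hlt2 := lt_of_le_of_ne (hnm P' hP') hn'
      -- Since n < m, the coefficients of u and v are p-th powers, as the uniqueness lemma requires.
      obtain ⟨k, hk⟩ := Nat.exists_eq_add_of_lt hlt1
      obtain ⟨k', hk'⟩ := Nat.exists_eq_add_of_lt hlt2
      have ek : m - n P = k + 1 := by omega
      have ek' : m - n P' = k' + 1 := by omega
      rw [ek, pow_succ, pow_mul, pow_mul] at e
      rw [ek', pow_succ, pow_mul, pow_mul] at e'
      obtain ⟨E1, E2⟩ := eq_and_eq_of_pow_mul_add_pow_mul_eq_one (p := p)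
        (x := ((u P : Lˣ) : L)) (y := ((v P : Lˣ) : L))
        (f := (α : L) ^ p ^ k) (g := (β : L) ^ p ^ k)
        (f' := (α : L) ^ p ^ k' * (w : Lˣ)) (g' := (β : L) ^ p ^ k' * (z : Lˣ)) (by
          rintro ⟨x, y, hx, hy⟩
          have hx0 : x ≠ 0 := by
            rintro rfl
            rw [zero_pow hp.out.ne_zero] at hx
            exact (u P : Lˣ).ne_zero hx.symm
          have hy0 : y ≠ 0 := by
            rintro rfl
            rw [zero_pow hp.out.ne_zero] at hy
            exact (v P : Lˣ).ne_zero hy.symm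
          exact hlt P hP hlt1 ⟨Units.mk0 x hx0, Units.mk0 y hy0, by ext; simpa using hx,
            by ext; simpa using hy⟩) (by simp) e (by rw [← e']; ring)
      have E1' : α ^ p ^ k = α ^ p ^ k' * w := by ext; simpa using E1.symm
      have E2' : β ^ p ^ k = β ^ p ^ k' * z := by ext; simpa using E2.symm
      by_cases hkk : k = k'
      · subst hkk
        have hw1 : (w : Lˣ) = 1 := by simpa using E1'
        have hz1 : (z : Lˣ) = 1 := by simpa using E2'
        refine hext P hP P' hP' (by omega) ?_ ?_
        · rw [huw]; ext; simp [hw1]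
        · rw [hvz]; ext; simp [hz1]
      -- Different levels would force α and β into Γ, hence a and b as well.
      · have hpk : p ^ k ≠ p ^ k' := fun h => hkk (Nat.pow_right_injective hp.out.two_le h)
        have hαΓ := Subgroup.mem_of_pow_eq_pow_mul hrad w.2 hpk E1'
        have hβΓ := Subgroup.mem_of_pow_eq_pow_mul hrad z.2 hpk E2'
        exact absurd ⟨(Subgroup.mul_mem_cancel_right _ hQ1).1 (hα ▸ pow_mem hαΓ _),
          (Subgroup.mul_mem_cancel_right _ hQ2).1 (hβ ▸ pow_mem hβΓ _)⟩ hab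
  have hcard := Finset.card_le_card (s := insert (false, 1, 1) (T.image κ)) (Finset.subset_univ _)
  rw [Finset.card_insert_of_notMem (by simpa using hmiss), Finset.card_image_of_injOn hinj,
    Finset.card_univ, Fintype.card_prod, Fintype.card_prod, Fintype.card_bool,
    ← Nat.card_eq_fintype_card] at hcard
  rwa [sq]

end

/-! ### From finite to arbitrary extensions of K -/

section

variable {K : Type*} [Field K] {S : Finset (Place K)} {L : Type*} [Field L] [Algebra K L]

theorem Units.map_mem_sUnitsIn {L' : Type*} [Field L'] [Algebra K L'] [Algebra L' L]
    [IsScalarTower K L' L] {x : L'ˣ} :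
    Units.map (algebraMap L' L).toMonoidHom x ∈ sUnitsIn S L ↔ x ∈ sUnitsIn S L' := by
  constructor
  · rintro ⟨u, hu, h⟩
    refine ⟨u, hu, ?_⟩
    ext
    apply (algebraMap L' L).injective
    simpa [← IsScalarTower.algebraMap_apply] using congrArg Units.val h
  · rintro ⟨u, hu, rfl⟩
    refine ⟨u, hu, ?_⟩
    ext
    simp [← IsScalarTower.algebraMap_apply]

theorem Units.map_mem_sqrtSUnits {L' : Type*} [Field L'] [Algebra K L'] [Algebra L' L]
    [IsScalarTower K L' L] {x : L'ˣ} :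
    Units.map (algebraMap L' L).toMonoidHom x ∈ sqrtSUnits S L ↔ x ∈ sqrtSUnits S L' := by
  refine exists_congr fun n => and_congr_right fun _ => ?_
  rw [← map_pow, Units.map_mem_sUnitsIn]

theorem isSTrivial_of_mem_sqrtSUnits {a b : Lˣ} (ha : a ∈ sqrtSUnits S L)
    (hb : b ∈ sqrtSUnits S L) : IsSTrivial S a b := by
  obtain ⟨m, hm, ha⟩ := ha
  obtain ⟨n, hn, hb⟩ := hb
  refine ⟨m * n, Nat.mul_pos hm hn, ?_, ?_⟩
  · rw [pow_mul]; exact pow_mem ha n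
  · rw [mul_comm, pow_mul]; exact pow_mem hb m

theorem isIntegral_of_mem_sqrtSUnits {x : Lˣ} (hx : x ∈ sqrtSUnits S L) :
    IsIntegral K (x : L) := by
  obtain ⟨n, hn, u, -, h⟩ := hx
  refine IsIntegral.of_pow hn ?_
  have := congrArg Units.val h
  simp only [Units.coe_map, Units.val_pow_eq_pow_val] at this
  rw [← this]
  exact isIntegral_algebraMap

/-- In a function field over a finite prime field, infinitely `p`-divisible units are roots of
unity. -/
theorem exists_pow_eq_one_of_forall_exists_pow {p : ℕ} [hp : Fact p.Prime] {E : Type*} [Field E]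
    [Algebra (ZMod p)⟮X⟯ E] [FiniteDimensional (ZMod p)⟮X⟯ E] {x : Eˣ}
    (hx : ∀ n : ℕ, ∃ y : Eˣ, y ^ p ^ n = x) : ∃ n : ℕ, 1 ≤ n ∧ x ^ n = 1 := by
  obtain ⟨n, hn, h⟩ := exists_pow_eq_one_of_forall_place_le_one (p := p) x.ne_zero fun v => by
    by_contra! hv
    have hv0 : v.1 (x : E) ≠ 0 := (Valuation.ne_zero_iff _).2 x.ne_zero
    rw [← WithZero.log_lt_log one_ne_zero hv0, WithZero.log_one] at hv
    -- A positive log equal to N would be divisible by p^N > N.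
    obtain ⟨y, hy⟩ := hx (WithZero.log (v.1 (x : E))).toNat
    have h1 := congrArg (fun z : Eˣ => WithZero.log (v.1 (z : E))) hy
    simp only [Units.val_pow_eq_pow_val, map_pow, WithZero.log_pow] at h1
    have h2 := Int.le_of_dvd hv (Dvd.intro _ ((nsmul_eq_mul _ _).symm.trans h1))
    have h3 := Nat.lt_pow_self (n := (WithZero.log (v.1 (x : E))).toNat) hp.out.one_lt
    omega
  exact ⟨n, hn, by ext; simpa using h⟩

/-- Two distinct solutions determine a and b by Cramer's rule, so a and b descend to any field
containing both solutions. -/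
theorem mem_adjoin_of_two_solutions {F : IntermediateField K L} {a b x y x' y' : L}
    (hx : x ∈ F) (hy : y ∈ F) (hx' : x' ∈ F) (hy' : y' ∈ F) (h : a * x + b * y = 1)
    (h' : a * x' + b * y' = 1) (hne : ¬ (x = x' ∧ y = y')) : a ∈ F ∧ b ∈ F := by
  have hd : x * y' - x' * y ≠ 0 := by
    intro hd
    apply hne
    constructor
    · linear_combination x' * h - x * h' + b * hd
    · linear_combination y' * h - y * h' - a * hd
  have hdF : x * y' - x' * y ∈ F := sub_mem (mul_mem hx hy') (mul_mem hx' hy)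
  have ha : a = (y' - y) / (x * y' - x' * y) := by
    rw [eq_div_iff hd]; linear_combination y' * h - y * h'
  have hb : b = (x - x') / (x * y' - x' * y) := by
    rw [eq_div_iff hd]; linear_combination x * h' - x' * h
  exact ⟨ha ▸ div_mem (sub_mem hy' hy) hdF, hb ▸ div_mem (sub_mem hx hx') hdF⟩

/-- The bound for finite sets of solutions in a finite extension of `K`. -/
theorem card_solutions_le_of_finiteDimensional (p : ℕ) [hp : Fact p.Prime]
    [Algebra (ZMod p)⟮X⟯ K] [FiniteDimensional (ZMod p)⟮X⟯ K] [FiniteDimensional K L]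
    (hS : S.Nonempty) {a b : Lˣ} (hab : ¬ IsSTrivial S a b) (T : Finset (Lˣ × Lˣ))
    (hT : (T : Set (Lˣ × Lˣ)) ⊆ sqrtSUnitSolutions S a b) :
    T.card + 1 ≤ 2 * p ^ (2 * S.card - 2) := by
  let _ : Algebra (ZMod p)⟮X⟯ L := ((algebraMap K L).comp (algebraMap (ZMod p)⟮X⟯ K)).toAlgebra
  have : IsScalarTower (ZMod p)⟮X⟯ K L := IsScalarTower.of_algebraMap_eq fun _ => rfl
  have : FiniteDimensional (ZMod p)⟮X⟯ L := FiniteDimensional.trans _ K L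
  have : CharP (ZMod p)⟮X⟯ p := charP_of_injective_algebraMap (algebraMap (ZMod p) _).injective p
  have : CharP L p := charP_of_injective_algebraMap (algebraMap (ZMod p)⟮X⟯ L).injective p
  obtain ⟨hfin, hcard⟩ := card_sqrtSUnits_quotient_le (L := L) p hS
  refine (card_le_of_forall_solution (p := p) (Γ := sqrtSUnits S L)
    (fun x n hn h => mem_sqrtSUnits_of_pow_mem hn h) (fun x hx => ?_)
    (fun h => hab (isSTrivial_of_mem_sqrtSUnits h.1 h.2)) T fun P hP => hT hP).trans ?_
  · obtain ⟨n, hn, h⟩ := exists_pow_eq_one_of_forall_exists_pow hx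
    exact ⟨n, hn, h ▸ one_mem _⟩
  · rw [show 2 * S.card - 2 = (S.card - 1) * 2 by omega, pow_mul]
    gcongr

/-- The bound for finite sets of solutions in an arbitrary extension of `K`. -/
theorem card_solutions_le (p : ℕ) [hp : Fact p.Prime] [Algebra (ZMod p)⟮X⟯ K]
    [FiniteDimensional (ZMod p)⟮X⟯ K] (hS : S.Nonempty) {a b : Lˣ} (hab : ¬ IsSTrivial S a b)
    (T : Finset (Lˣ × Lˣ)) (hT : (T : Set (Lˣ × Lˣ)) ⊆ sqrtSUnitSolutions S a b) :
    T.card + 1 ≤ 2 * p ^ (2 * S.card - 2) := by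
  classical
  rcases le_or_gt T.card 1 with h1 | h1
  · have := Nat.one_le_pow (2 * S.card - 2) p hp.out.pos
    omega
  obtain ⟨P, hP, P', hP', hne⟩ := Finset.one_lt_card.1 h1
  let C : Set L := (fun P : Lˣ × Lˣ => (P.1 : L)) '' T ∪ (fun P : Lˣ × Lˣ => (P.2 : L)) '' T
  have hC : C.Finite := (T.finite_toSet.image _).union (T.finite_toSet.image _)
  let F := IntermediateField.adjoin K C
  have h1F (P) (hP : P ∈ T) : (P.1 : L) ∈ F :=
    IntermediateField.subset_adjoin K C (Or.inl ⟨P, hP, rfl⟩)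
  have h2F (P) (hP : P ∈ T) : (P.2 : L) ∈ F :=
    IntermediateField.subset_adjoin K C (Or.inr ⟨P, hP, rfl⟩)
  have : Finite C := hC
  have : FiniteDimensional K F := IntermediateField.finiteDimensional_adjoin fun x hx => by
    rcases hx with ⟨P, hP, rfl⟩ | ⟨P, hP, rfl⟩
    · exact isIntegral_of_mem_sqrtSUnits (hT hP).1
    · exact isIntegral_of_mem_sqrtSUnits (hT hP).2.1
  obtain ⟨haF, hbF⟩ := mem_adjoin_of_two_solutions (h1F P hP) (h2F P hP) (h1F P' hP') (h2F P' hP')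
    (hT hP).2.2 (hT hP').2.2 fun h => hne (Prod.ext (Units.ext h.1) (Units.ext h.2))
  let ι : Fˣ →* Lˣ := Units.map (algebraMap F L).toMonoidHom
  have hι : Function.Injective ι := Units.map_injective (algebraMap F L).injective
  have hlift (x : Lˣ) (hx : (x : L) ∈ F) : ∃ y : Fˣ, ι y = x :=
    ⟨Units.mk0 ⟨x, hx⟩ fun h => x.ne_zero (congrArg Subtype.val h), by ext; rfl⟩
  obtain ⟨a, rfl⟩ := hlift a haF
  obtain ⟨b, rfl⟩ := hlift b hbF
  let T' := T.preimage (Prod.map ι ι) (hι.prodMap hι).injOn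
  have hTT' : T.card ≤ T'.card := by
    refine (Finset.card_le_card (t := T'.image (Prod.map ι ι)) fun P hP => ?_).trans
      Finset.card_image_le
    obtain ⟨x, hx⟩ := hlift P.1 (h1F P hP)
    obtain ⟨y, hy⟩ := hlift P.2 (h2F P hP)
    have hxy : Prod.map ι ι (x, y) = P := Prod.ext hx hy
    exact Finset.mem_image.2 ⟨(x, y), Finset.mem_preimage.2 (hxy ▸ hP), hxy⟩
  refine (Nat.succ_le_succ hTT').trans
    (card_solutions_le_of_finiteDimensional p hS (a := a) (b := b) ?_ T' fun P hP => ?_)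
  · rintro ⟨n, hn, ha, hb⟩
    exact hab ⟨n, hn, by rwa [← map_pow, Units.map_mem_sUnitsIn],
      by rwa [← map_pow, Units.map_mem_sUnitsIn]⟩
  · obtain ⟨h1, h2, h3⟩ := hT (Finset.mem_preimage.1 hP)
    refine ⟨Units.map_mem_sqrtSUnits.1 h1, Units.map_mem_sqrtSUnits.1 h2, ?_⟩
    apply (algebraMap F L).injective
    simpa [ι] using h3

end

theorem Set.finite_and_ncard_le_of_forall_finset {α : Type*} {s : Set α} {n : ℕ}
    (h : ∀ T : Finset α, (T : Set α) ⊆ s → T.card ≤ n) : s.Finite ∧ s.ncard ≤ n := by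
  have hfin : s.Finite := by
    by_contra hinf
    obtain ⟨T, hT, hc⟩ := Set.Infinite.exists_subset_card_eq hinf (n + 1)
    have := h T hT
    omega
  refine ⟨hfin, ?_⟩
  rw [Set.ncard_eq_toFinset_card s hfin]
  exact h _ (by simp)

theorem theorem2p6 (p : ℕ) [Fact p.Prime]
    (K : Type*) [Field K] [Algebra (ZMod p)⟮X⟯ K] [FiniteDimensional (ZMod p)⟮X⟯ K]
    (S : Finset (Place K)) (hS : 1 ≤ S.card)
    (L : Type*) [Field L] [Algebra K L] (hL : IsClassRadicalExtension p S L)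
    (a b : Lˣ) (hab : ¬ IsSTrivial S a b) :
    (sqrtSUnitSolutions S a b).Finite ∧
      ((sqrtSUnitSolutions S a b).ncard : ℚ) ≤
        (p : ℚ) ^ (2 * S.card - 2) * ((p : ℚ) ^ (2 * S.card - 2) + p - 2) / (p - 1) := by
  have hp : p.Prime := Fact.out
  obtain ⟨hfin, hle⟩ := Set.finite_and_ncard_le_of_forall_finset
    (s := sqrtSUnitSolutions S a b) (n := 2 * p ^ (2 * S.card - 2) - 1) fun T hT => by
      have := card_solutions_le p (Finset.card_pos.1 hS) hab T hT
      omega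
  refine ⟨hfin, ?_⟩
  have hp1 : (1 : ℚ) < p := by exact_mod_cast hp.one_lt
  have hq1 : 1 ≤ p ^ (2 * S.card - 2) := Nat.one_le_pow _ _ hp.pos
  have hle' : ((sqrtSUnitSolutions S a b).ncard : ℚ) + 1 ≤ 2 * (p : ℚ) ^ (2 * S.card - 2) := by
    exact_mod_cast (show (sqrtSUnitSolutions S a b).ncard + 1 ≤ 2 * p ^ (2 * S.card - 2) by omega)
  -- This product is the difference of the two bounds times p - 1. The first factor vanishes when
  -- |S| = 1; otherwise the power of p is at least p.
  have hprod : 0 ≤ ((p : ℚ) ^ (2 * S.card - 2) - 1) * ((p : ℚ) ^ (2 * S.card - 2) + 1 - p) := by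
    rcases Nat.eq_zero_or_pos (2 * S.card - 2) with h0 | h0
    · simp [h0]
    · have h1 : (p : ℚ) ≤ (p : ℚ) ^ (2 * S.card - 2) := le_self_pow₀ hp1.le h0.ne'
      exact mul_nonneg (by linarith) (by linarith)
  rw [le_div_iff₀ (by linarith)]
  calc _ ≤ (2 * (p : ℚ) ^ (2 * S.card - 2) - 1) * (p - 1) :=
        mul_le_mul_of_nonneg_right (by linarith) (by linarith)
    _ ≤ _ := by linarith
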